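/- Let $\Omega\subset\mathbb{R}^n$ be a bounded open set (for instance a bounded domain) and let $f:\Omega\times\mathbb{R}\to\mathbb{R}$, $(x,s)\mapsto f(x,s)$, be a $C^1$ function such that $s\mapsto f(x,s)$ is convex for every $x\in\Omega$ and such that $f'(x,s):=\partial_s f(x,s)$ is bounded on $\Omega\times[-M,M]$ for every $M>0$. (The smoothness and the boundedness hold in particular if $f\in C^{1,1}$, in the sense that $f$ is $C^1$ and its first derivatives are Lipschitz on $\Omega\times[-M,M]$ for every $M$.) Consider the problem $$-\Delta u=f(x,u)\ \text{ in }\Omega,\qquad u=0\ \text{ on }\partial\Omega. \tag{$*$}$$ A solution is a function $u\in C^2(\Omega)\cap C(\overline\Omega)$ that satisfies $(*)$ pointwise; it is positive if $u>0$ in $\Omega$, and it is stable if $$\int_\Omega|\nabla\phi|^2\,dx-\int_\Omega f'(x,u(x))\,\phi^2\,dx>0\qquad\text{for every }\phi\in H^1_0(\Omega),\ \phi\neq0.$$ Then $(*)$ has at most one positive stable solution: if $u$ and $v$ are positive stable solutions of $(*)$, then $u=v$ on $\overline\Omega$. -/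

import Mathlib

open MeasureTheory Filter Topology Set

noncomputable section

namespace StableElliptic

/-- `η` is a test function on `Ω`, i.e. `η ∈ C_c^∞(Ω)`. -/
def IsTestFunction {n : ℕ} (Ω : Set (EuclideanSpace ℝ (Fin n)))
    (η : EuclideanSpace ℝ (Fin n) → ℝ) : Prop :=
  ContDiff ℝ (⊤ : ℕ∞) η ∧ HasCompactSupport η ∧ tsupport η ⊆ Ω

/-- `g` is the weak gradient of `φ` in the open set `Ω`: both are locally integrable in `Ω` and
`∫_Ω φ ∂_e η = - ∫_Ω (g · e) η` for all test functions `η` and all directions `e`. -/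
def HasWeakGradient {n : ℕ} (Ω : Set (EuclideanSpace ℝ (Fin n)))
    (φ : EuclideanSpace ℝ (Fin n) → ℝ)
    (g : EuclideanSpace ℝ (Fin n) → EuclideanSpace ℝ (Fin n)) : Prop :=
  LocallyIntegrableOn φ Ω ∧ LocallyIntegrableOn g Ω ∧
    ∀ η : EuclideanSpace ℝ (Fin n) → ℝ, IsTestFunction Ω η →
      ∀ e : EuclideanSpace ℝ (Fin n),
        ∫ x in Ω, φ x * fderiv ℝ η x e = - ∫ x in Ω, inner ℝ (g x) e * η x

/-- `φ ∈ H¹(Ω)`, with weak gradient `g`. -/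
def MemH1 {n : ℕ} (Ω : Set (EuclideanSpace ℝ (Fin n)))
    (φ : EuclideanSpace ℝ (Fin n) → ℝ)
    (g : EuclideanSpace ℝ (Fin n) → EuclideanSpace ℝ (Fin n)) : Prop :=
  MemLp φ 2 (volume.restrict Ω) ∧ MemLp g 2 (volume.restrict Ω) ∧ HasWeakGradient Ω φ g

/-- `φ ∈ H¹₀(Ω)`, with weak gradient `g`: the function `φ` lies in the closure of `C_c^∞(Ω)`
in `H¹(Ω)`. -/
def MemH10 {n : ℕ} (Ω : Set (EuclideanSpace ℝ (Fin n)))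
    (φ : EuclideanSpace ℝ (Fin n) → ℝ)
    (g : EuclideanSpace ℝ (Fin n) → EuclideanSpace ℝ (Fin n)) : Prop :=
  MemH1 Ω φ g ∧
    ∃ ψ : ℕ → EuclideanSpace ℝ (Fin n) → ℝ, (∀ k, IsTestFunction Ω (ψ k)) ∧
      Tendsto (fun k => eLpNorm (fun x => ψ k x - φ x) 2 (volume.restrict Ω)) atTop (𝓝 0) ∧
      Tendsto (fun k => eLpNorm (fun x => gradient (ψ k) x - g x) 2 (volume.restrict Ω))
        atTop (𝓝 0)

/-- `u ∈ C²(Ω) ∩ C(Ω̄)` is a (classical) solution of `-Δu = f(x,u)` in `Ω`,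
`u = 0` on `∂Ω`. -/
structure IsSolution {n : ℕ} (Ω : Set (EuclideanSpace ℝ (Fin n)))
    (f : EuclideanSpace ℝ (Fin n) → ℝ → ℝ) (u : EuclideanSpace ℝ (Fin n) → ℝ) : Prop where
  contDiffOn : ContDiffOn ℝ 2 u Ω
  continuousOn : ContinuousOn u (closure Ω)
  eq_interior : ∀ x ∈ Ω, -(Laplacian.laplacian u x) = f x (u x)
  eq_boundary : ∀ x ∈ frontier Ω, u x = 0

/-- `u` is stable: the quadratic form of the linearized operator `-Δ - f'(·,u)`, where `f'` is
the derivative of `f` in its second variable, is positive at all `φ ≠ 0` in `H¹₀(Ω)`. -/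
def IsStable {n : ℕ} (Ω : Set (EuclideanSpace ℝ (Fin n)))
    (f : EuclideanSpace ℝ (Fin n) → ℝ → ℝ) (u : EuclideanSpace ℝ (Fin n) → ℝ) : Prop :=
  ∀ (φ : EuclideanSpace ℝ (Fin n) → ℝ)
    (g : EuclideanSpace ℝ (Fin n) → EuclideanSpace ℝ (Fin n)), MemH10 Ω φ g →
    ¬ (φ =ᵐ[volume.restrict Ω] 0) →
    0 < (∫ x in Ω, ‖g x‖ ^ 2) - ∫ x in Ω, deriv (f x) (u x) * φ x ^ 2

/-- `u` is a positive stable solution of `-Δu = f(x,u)` in `Ω`, `u = 0` on `∂Ω`. -/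
structure IsPositiveStableSolution {n : ℕ} (Ω : Set (EuclideanSpace ℝ (Fin n)))
    (f : EuclideanSpace ℝ (Fin n) → ℝ → ℝ) (u : EuclideanSpace ℝ (Fin n) → ℝ) : Prop where
  isSolution : IsSolution Ω f u
  pos : ∀ x ∈ Ω, 0 < u x
  isStable : IsStable Ω f u

end StableElliptic

end

namespace StableElliptic

/-! Let `w = u - v` and test the equation for `w` with `w⁺ = max w 0`. Convexity puts `f x` above
its tangent at `u x`, so `f x (u x) - f x (v x) ≤ f' x (u x) * w x`, and therefore `∫ |∇w⁺|² ≤ ∫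
(f(·,u) - f(·,v)) w⁺ ≤ ∫ f'(·,u) (w⁺)²`. Stability of `u` forbids this unless `w⁺ = 0`, so `u ≤ v`
(`le_of_isStable`); exchanging the roles of `u` and `v` gives equality.

The work lies in testing with `w⁺`: the boundary is arbitrary and `∇w` is not known to be square
integrable. `memH10_posPart` therefore replaces `w⁺` by `trunc ε (w ·)`. Since `w` is continuous up
to the boundary and vanishes there, this function has compact support in `Ω`, and it is `C¹`, so
Green's identity applies to it (`integral_mul_laplacian`). As `ε → 0`, boundedness of `Δw` controls
one side and Fatou's lemma the other. This yields both `∇w⁺ ∈ L²` and the energy inequality;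
equality is not needed. Mollification turns the truncations into genuine test functions. -/

/-! ### Truncations of the positive part on the real line. -/

/-- The slope of the truncation: `0` below `ε`, `1` above `2ε`, linear in between. -/
noncomputable def truncSlope (ε t : ℝ) : ℝ := max 0 (min 1 (t / ε - 1))

/-- A `C¹` approximation of the positive part that vanishes below `ε`. -/
noncomputable def trunc (ε s : ℝ) : ℝ := ∫ t in (0 : ℝ)..s, truncSlope ε t

theorem continuous_truncSlope (ε : ℝ) : Continuous (truncSlope ε) := by
  unfold truncSlope; fun_prop

theorem truncSlope_nonneg (ε t : ℝ) : 0 ≤ truncSlope ε t := le_max_left _ _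

theorem truncSlope_le_one (ε t : ℝ) : truncSlope ε t ≤ 1 :=
  max_le zero_le_one (min_le_left _ _)

theorem truncSlope_eq_zero {ε t : ℝ} (hε : 0 < ε) (ht : t ≤ ε) : truncSlope ε t = 0 := by
  have : t / ε ≤ 1 := (div_le_one hε).2 ht
  exact max_eq_left ((min_le_right _ _).trans (by linarith))

theorem truncSlope_eq_one {ε t : ℝ} (hε : 0 < ε) (ht : 2 * ε ≤ t) : truncSlope ε t = 1 := by
  have : 2 ≤ t / ε := (le_div_iff₀ hε).2 ht
  rw [truncSlope, min_eq_left (by linarith), max_eq_right zero_le_one]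

theorem hasDerivAt_trunc (ε s : ℝ) : HasDerivAt (trunc ε) (truncSlope ε s) s :=
  ((continuous_truncSlope ε).integral_hasStrictDerivAt 0 s).hasDerivAt

theorem contDiff_trunc (ε : ℝ) : ContDiff ℝ 1 (trunc ε) := by
  rw [contDiff_one_iff_deriv]
  refine ⟨fun s => (hasDerivAt_trunc ε s).differentiableAt, ?_⟩
  rw [funext fun s => (hasDerivAt_trunc ε s).deriv]
  exact continuous_truncSlope ε

theorem trunc_eq_zero {ε s : ℝ} (hε : 0 < ε) (hs : s ≤ ε) : trunc ε s = 0 := by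
  have : ∫ t in (0 : ℝ)..s, truncSlope ε t = ∫ t in (0 : ℝ)..s, (0 : ℝ) := by
    refine intervalIntegral.integral_congr fun t ht => truncSlope_eq_zero hε ?_
    exact ht.2.trans (max_le hε.le hs)
  rw [trunc, this]; simp

theorem trunc_nonneg {ε : ℝ} (hε : 0 < ε) (s : ℝ) : 0 ≤ trunc ε s := by
  rcases le_total s 0 with hs | hs
  · rw [trunc_eq_zero hε (hs.trans hε.le)]
  · exact intervalIntegral.integral_nonneg hs fun t _ => truncSlope_nonneg ε t

theorem trunc_le {ε : ℝ} (hε : 0 < ε) (s : ℝ) : trunc ε s ≤ max s 0 := by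
  rcases le_total s 0 with hs | hs
  · rw [trunc_eq_zero hε (hs.trans hε.le)]; exact le_max_right _ _
  · have := intervalIntegral.integral_mono_on (μ := volume) hs
      ((continuous_truncSlope ε).intervalIntegrable 0 s)
      (continuous_const.intervalIntegrable (μ := volume) (0 : ℝ) s)
      fun t _ => truncSlope_le_one ε t
    simp only [intervalIntegral.integral_const, sub_zero, smul_eq_mul, mul_one] at this
    exact this.trans (le_max_left _ _)

theorem tendsto_truncSlope {ε : ℕ → ℝ} (hε : ∀ k, 0 < ε k) (hε0 : Tendsto ε atTop (𝓝 0))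
    {t : ℝ} (ht : 0 < t) : Tendsto (fun k => truncSlope (ε k) t) atTop (𝓝 1) := by
  refine tendsto_const_nhds.congr' ?_
  filter_upwards [hε0.eventually_lt_const (half_pos ht)] with k hk
  exact (truncSlope_eq_one (hε k) (by linarith)).symm

theorem tendsto_trunc {ε : ℕ → ℝ} (hε : ∀ k, 0 < ε k) (hε0 : Tendsto ε atTop (𝓝 0)) (s : ℝ) :
    Tendsto (fun k => trunc (ε k) s) atTop (𝓝 (max s 0)) := by
  rcases le_or_gt s 0 with hs | hs
  · rw [max_eq_right hs]
    exact tendsto_const_nhds.congr fun k => (trunc_eq_zero (hε k) (hs.trans (hε k).le)).symm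
  · have h1 : max s 0 = ∫ _ in (0 : ℝ)..s, (1 : ℝ) := by simp [hs.le]
    rw [h1]
    refine intervalIntegral.tendsto_integral_filter_of_dominated_convergence (fun _ => 1)
      (Eventually.of_forall fun k => (continuous_truncSlope _).aestronglyMeasurable)
      (Eventually.of_forall fun k => ae_of_all _ fun t _ => ?_)
      (continuous_const.intervalIntegrable _ _) (ae_of_all _ fun t ht => ?_)
    · rw [Real.norm_of_nonneg (truncSlope_nonneg _ _)]; exact truncSlope_le_one _ _
    · rw [uIoc_of_le hs.le] at ht
      exact tendsto_truncSlope hε hε0 ht.1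

/-! ### Mollification: from compactly supported `C¹` functions to test functions. -/

/-- A compactly supported `C¹` function in an open set is approximated uniformly, together with
its derivative, by test functions. -/
theorem exists_testFunction_near {n : ℕ} {Ω : Set (EuclideanSpace ℝ (Fin n))} (hΩ : IsOpen Ω)
    {ψ : EuclideanSpace ℝ (Fin n) → ℝ} (hψ : ContDiff ℝ 1 ψ) (hc : HasCompactSupport ψ)
    (hs : tsupport ψ ⊆ Ω) {δ : ℝ} (hδ : 0 < δ) :
    ∃ η, IsTestFunction Ω η ∧ (∀ x, ‖η x - ψ x‖ ≤ δ) ∧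
      ∀ x, ‖fderiv ℝ η x - fderiv ℝ ψ x‖ ≤ δ := by
  obtain ⟨r, hr, hrΩ⟩ := hc.isCompact.exists_cthickening_subset_open hΩ hs
  have hcd : Continuous (fderiv ℝ ψ) := hψ.continuous_fderiv one_ne_zero
  obtain ⟨r₁, hr₁, h₁⟩ := Metric.uniformContinuous_iff.1
    (hc.uniformContinuous_of_continuous hψ.continuous) δ hδ
  obtain ⟨r₂, hr₂, h₂⟩ := Metric.uniformContinuous_iff.1
    ((hc.fderiv ℝ).uniformContinuous_of_continuous hcd) δ hδ
  -- A mollification radius `R` below `r` keeps the support in `Ω`; below `r₁` and `r₂`, the moduli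
  -- of uniform continuity, it moves `ψ` and its derivative by at most `δ`.
  let R := min r (min r₁ r₂)
  have hR : 0 < R := lt_min hr (lt_min hr₁ hr₂)
  let b : ContDiffBump (0 : EuclideanSpace ℝ (Fin n)) := ⟨R / 2, R, half_pos hR, half_lt_self hR⟩
  let η := convolution (b.normed volume) ψ (ContinuousLinearMap.lsmul ℝ ℝ) volume
  have hbi : LocallyIntegrable (b.normed volume) volume :=
    b.continuous_normed.locallyIntegrable
  have hsub : tsupport η ⊆ Metric.cthickening r (tsupport ψ) := by
    refine closure_minimal ?_ Metric.isClosed_cthickening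
    refine (support_convolution_subset_swap _).trans ?_
    rw [b.support_normed_eq]
    rintro _ ⟨y, hy, z, hz, rfl⟩
    refine Metric.mem_cthickening_of_dist_le _ y _ _ (subset_tsupport _ hy) ?_
    rw [mem_ball_zero_iff] at hz
    simpa using hz.le.trans (min_le_left _ _)
  refine ⟨η, ⟨?_, ?_, hsub.trans hrΩ⟩, fun x => ?_, fun x => ?_⟩
  · exact b.hasCompactSupport_normed.contDiff_convolution_left _ b.contDiff_normed
      hψ.continuous.locallyIntegrable
  · exact b.hasCompactSupport_normed.convolution _ hc
  · rw [← dist_eq_norm]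
    refine b.dist_normed_convolution_le hψ.continuous.aestronglyMeasurable fun y hy => ?_
    exact (h₁ (lt_of_lt_of_le hy ((min_le_right _ _).trans (min_le_left _ _)))).le
  · have hd := (hc.hasFDerivAt_convolution_right (ContinuousLinearMap.lsmul ℝ ℝ) hbi hψ x).fderiv
    have he : convolution (b.normed volume) (fderiv ℝ ψ)
        ((ContinuousLinearMap.lsmul ℝ ℝ).precompR (EuclideanSpace ℝ (Fin n))) volume x =
        convolution (b.normed volume) (fderiv ℝ ψ) (ContinuousLinearMap.lsmul ℝ ℝ) volume x := by
      simp only [convolution]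
      congr 1
    change ‖fderiv ℝ (convolution (b.normed volume) ψ (ContinuousLinearMap.lsmul ℝ ℝ) volume) x
      - _‖ ≤ δ
    rw [hd, he, ← dist_eq_norm]
    refine b.dist_normed_convolution_le hcd.aestronglyMeasurable fun y hy => ?_
    exact (h₂ (lt_of_lt_of_le hy ((min_le_right _ _).trans (min_le_right _ _)))).le

theorem norm_gradient_sub {n : ℕ} (f g : EuclideanSpace ℝ (Fin n) → ℝ)
    (x : EuclideanSpace ℝ (Fin n)) :
    ‖gradient f x - gradient g x‖ = ‖fderiv ℝ f x - fderiv ℝ g x‖ := by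
  rw [gradient, gradient, ← map_sub, LinearIsometryEquiv.norm_map]

/-- `H¹` limits of compactly supported `C¹` functions are `H¹` limits of test functions. -/
theorem exists_testFunction_tendsto {n : ℕ} {Ω : Set (EuclideanSpace ℝ (Fin n))} (hΩ : IsOpen Ω)
    (hb : Bornology.IsBounded Ω)
    {φ : EuclideanSpace ℝ (Fin n) → ℝ} {g : EuclideanSpace ℝ (Fin n) → EuclideanSpace ℝ (Fin n)}
    (hφ : AEStronglyMeasurable φ (volume.restrict Ω))
    (hg : AEStronglyMeasurable g (volume.restrict Ω))
    {ψ : ℕ → EuclideanSpace ℝ (Fin n) → ℝ} (hψ : ∀ k, ContDiff ℝ 1 (ψ k))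
    (hc : ∀ k, HasCompactSupport (ψ k)) (hs : ∀ k, tsupport (ψ k) ⊆ Ω)
    (h0 : Tendsto (fun k => eLpNorm (fun x => ψ k x - φ x) 2 (volume.restrict Ω)) atTop (𝓝 0))
    (h1 : Tendsto (fun k => eLpNorm (fun x => gradient (ψ k) x - g x) 2 (volume.restrict Ω))
        atTop (𝓝 0)) :
    ∃ η : ℕ → EuclideanSpace ℝ (Fin n) → ℝ, (∀ k, IsTestFunction Ω (η k)) ∧
      Tendsto (fun k => eLpNorm (fun x => η k x - φ x) 2 (volume.restrict Ω)) atTop (𝓝 0) ∧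
      Tendsto (fun k => eLpNorm (fun x => gradient (η k) x - g x) 2 (volume.restrict Ω))
        atTop (𝓝 0) := by
  have hgc : ∀ ζ : EuclideanSpace ℝ (Fin n) → ℝ, ContDiff ℝ 1 ζ → Continuous (gradient ζ) :=
    fun ζ hζ => (InnerProductSpace.toDual ℝ _).symm.continuous.comp
      (hζ.continuous_fderiv one_ne_zero)
  choose η hη hη0 hη1 using fun k : ℕ =>
    exists_testFunction_near hΩ (hψ k) (hc k) (hs k) (Nat.one_div_pos_of_nat (α := ℝ) (n := k))
  have hη' : ∀ k, ContDiff ℝ 1 (η k) := fun k => (hη k).1.of_le (by norm_cast)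
  -- `V = |Ω|^(1/2)` converts uniform bounds into `L²` bounds; it is finite because `Ω` is bounded.
  set V := volume.restrict Ω univ ^ (2 : ENNReal).toReal⁻¹
  have hVtop : V ≠ ⊤ := by
    have : volume.restrict Ω univ ≠ ⊤ := by simpa using hb.measure_lt_top.ne
    exact ENNReal.rpow_ne_top_of_nonneg (by positivity) this
  have hlim : Tendsto (fun k : ℕ => V * ENNReal.ofReal (1 / ((k : ℝ) + 1))) atTop (𝓝 0) := by
    have := ENNReal.tendsto_ofReal (tendsto_one_div_add_atTop_nhds_zero_nat (𝕜 := ℝ))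
    rw [ENNReal.ofReal_zero] at this
    simpa using ENNReal.Tendsto.const_mul this (Or.inr hVtop)
  refine ⟨η, hη, ?_, ?_⟩
  · have hsum := hlim.add h0
    rw [add_zero] at hsum
    refine tendsto_of_tendsto_of_tendsto_of_le_of_le tendsto_const_nhds hsum
      (fun _ => zero_le) fun k => ?_
    have : (fun x => η k x - φ x) = (fun x => η k x - ψ k x) + fun x => ψ k x - φ x := by
      ext x; simp
    rw [this]
    refine (eLpNorm_add_le ((hη' k).continuous.sub (hψ k).continuous).aestronglyMeasurable
      ((hψ k).continuous.aestronglyMeasurable.sub hφ) one_le_two).trans ?_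
    refine add_le_add ?_ le_rfl
    exact eLpNorm_le_of_ae_bound (ae_of_all _ fun x => hη0 k x)
  · have hsum := hlim.add h1
    rw [add_zero] at hsum
    refine tendsto_of_tendsto_of_tendsto_of_le_of_le tendsto_const_nhds hsum
      (fun _ => zero_le) fun k => ?_
    have : (fun x => gradient (η k) x - g x) =
        (fun x => gradient (η k) x - gradient (ψ k) x) + fun x => gradient (ψ k) x - g x := by
      ext x; simp
    rw [this]
    refine (eLpNorm_add_le ((hgc _ (hη' k)).sub (hgc _ (hψ k))).aestronglyMeasurable
      ((hgc _ (hψ k)).aestronglyMeasurable.sub hg) one_le_two).trans ?_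
    refine add_le_add ?_ le_rfl
    exact eLpNorm_le_of_ae_bound (ae_of_all _ fun x => (norm_gradient_sub _ _ x).trans_le (hη1 k x))

/-! ### Integration by parts and Green's identity. -/

/-- Continuity is asked only on `K` because the integrands contain derivatives that are controlled
only inside `Ω`. -/
theorem integrable_of_continuousOn_compact {n : ℕ} {K : Set (EuclideanSpace ℝ (Fin n))}
    (hK : IsCompact K) {F : EuclideanSpace ℝ (Fin n) → ℝ} (hF : ContinuousOn F K)
    (h0 : ∀ x, x ∉ K → F x = 0) : Integrable F := by
  refine (integrableOn_iff_integrable_of_support_subset fun x hx => ?_).1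
    (hF.integrableOn_compact hK)
  by_contra h
  exact hx (h0 x h)

theorem fderiv_eq_zero_of_notMem_tsupport {n : ℕ} {ψ : EuclideanSpace ℝ (Fin n) → ℝ}
    {x : EuclideanSpace ℝ (Fin n)} (hx : x ∉ tsupport ψ) : fderiv ℝ ψ x = 0 := by
  by_contra h
  exact hx (support_fderiv_subset ℝ h)

/-- Integration by parts against a compactly supported `C¹` function. -/
theorem integral_mul_fderiv_eq_neg_of_hasCompactSupport {n : ℕ}
    {Ω : Set (EuclideanSpace ℝ (Fin n))} (hΩ : IsOpen Ω)
    {ψ : EuclideanSpace ℝ (Fin n) → ℝ} (hψ : ContDiff ℝ 1 ψ) (hc : HasCompactSupport ψ)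
    (hs : tsupport ψ ⊆ Ω) {a : EuclideanSpace ℝ (Fin n) → ℝ} (ha : ContDiffOn ℝ 1 a Ω)
    (e : EuclideanSpace ℝ (Fin n)) :
    Integrable (fun x => ψ x * fderiv ℝ a x e) ∧ Integrable (fun x => fderiv ℝ ψ x e * a x) ∧
    ∫ x in Ω, ψ x * fderiv ℝ a x e = - ∫ x in Ω, fderiv ℝ ψ x e * a x := by
  have hψ0 : ∀ x, x ∉ tsupport ψ → ψ x = 0 := fun x => image_eq_zero_of_notMem_tsupport
  have hψ1 : ∀ x, x ∉ tsupport ψ → fderiv ℝ ψ x e = 0 := fun x hx => by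
    simp [fderiv_eq_zero_of_notMem_tsupport hx]
  have hda : ContinuousOn (fun x => fderiv ℝ a x e) Ω :=
    (ha.continuousOn_fderiv_of_isOpen hΩ le_rfl).clm_apply continuousOn_const
  have hdψ : Continuous fun x => fderiv ℝ ψ x e :=
    (hψ.continuous_fderiv one_ne_zero).clm_apply continuous_const
  have i1 : Integrable (fun x => ψ x * fderiv ℝ a x e) :=
    integrable_of_continuousOn_compact hc.isCompact
      (hψ.continuous.continuousOn.mul (hda.mono hs)) fun x hx => by simp [hψ0 x hx]
  have i2 : Integrable (fun x => fderiv ℝ ψ x e * a x) :=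
    integrable_of_continuousOn_compact hc.isCompact
      (hdψ.continuousOn.mul (ha.continuousOn.mono hs)) fun x hx => by simp [hψ1 x hx]
  refine ⟨i1, i2, ?_⟩
  have i3 : Integrable (fun x => ψ x * a x) :=
    integrable_of_continuousOn_compact hc.isCompact
      (hψ.continuous.continuousOn.mul (ha.continuousOn.mono hs)) fun x hx => by simp [hψ0 x hx]
  -- Both integrands vanish off `Ω`, so the formula on the whole space applies; it needs `a`
  -- differentiable only on `tsupport ψ`.
  rw [setIntegral_eq_integral_of_forall_compl_eq_zero
      (fun x hx => by simp [hψ0 x fun h => hx (hs h)]),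
    setIntegral_eq_integral_of_forall_compl_eq_zero
      (fun x hx => by simp [hψ1 x fun h => hx (hs h)])]
  exact integral_mul_fderiv_eq_neg_fderiv_mul_of_integrable i2 i1 i3
    (fun x _ => (hψ.differentiable one_ne_zero) x)
    (fun x hx => (ha.contDiffAt (hΩ.mem_nhds (hs hx))).differentiableAt one_ne_zero)

theorem contDiffOn_fderiv_apply {n : ℕ} {Ω : Set (EuclideanSpace ℝ (Fin n))} (hΩ : IsOpen Ω)
    {w : EuclideanSpace ℝ (Fin n) → ℝ} (hw : ContDiffOn ℝ 2 w Ω) (e : EuclideanSpace ℝ (Fin n)) :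
    ContDiffOn ℝ 1 (fun x => fderiv ℝ w x e) Ω :=
  (hw.fderiv_of_isOpen hΩ (by norm_num)).clm_apply contDiffOn_const

/-- Each summand is a directional derivative of a `C¹` function on `Ω`, the form needed to integrate
by parts direction by direction. -/
theorem laplacian_eq_sum_fderiv {n : ℕ} {Ω : Set (EuclideanSpace ℝ (Fin n))} (hΩ : IsOpen Ω)
    {w : EuclideanSpace ℝ (Fin n) → ℝ} (hw : ContDiffOn ℝ 2 w Ω)
    {x : EuclideanSpace ℝ (Fin n)} (hx : x ∈ Ω) :
    Laplacian.laplacian w x = ∑ i, fderiv ℝ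
      (fun y => fderiv ℝ w y (EuclideanSpace.basisFun (Fin n) ℝ i)) x
        (EuclideanSpace.basisFun (Fin n) ℝ i) := by
  rw [InnerProductSpace.laplacian_eq_iteratedFDeriv_orthonormalBasis w
    (EuclideanSpace.basisFun (Fin n) ℝ)]
  refine Finset.sum_congr rfl fun i _ => ?_
  have hd : DifferentiableAt ℝ (fderiv ℝ w) x :=
    ((hw.fderiv_of_isOpen hΩ (m := 1) (by norm_num)).contDiffAt
      (hΩ.mem_nhds hx)).differentiableAt one_ne_zero
  rw [iteratedFDeriv_two_apply, fderiv_clm_apply hd (differentiableAt_const _)]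
  simp

theorem continuousOn_laplacian {n : ℕ} {Ω : Set (EuclideanSpace ℝ (Fin n))} (hΩ : IsOpen Ω)
    {w : EuclideanSpace ℝ (Fin n) → ℝ} (hw : ContDiffOn ℝ 2 w Ω) :
    ContinuousOn (Laplacian.laplacian w) Ω := by
  refine ContinuousOn.congr (continuousOn_finsetSum _ fun i _ => ?_)
    fun x hx => laplacian_eq_sum_fderiv hΩ hw hx
  exact ((contDiffOn_fderiv_apply hΩ hw _).continuousOn_fderiv_of_isOpen hΩ le_rfl).clm_apply
    continuousOn_const

/-- Green's first identity against a compactly supported `C¹` function. -/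
theorem integral_mul_laplacian {n : ℕ} {Ω : Set (EuclideanSpace ℝ (Fin n))} (hΩ : IsOpen Ω)
    {ψ : EuclideanSpace ℝ (Fin n) → ℝ} (hψ : ContDiff ℝ 1 ψ) (hc : HasCompactSupport ψ)
    (hs : tsupport ψ ⊆ Ω) {w : EuclideanSpace ℝ (Fin n) → ℝ} (hw : ContDiffOn ℝ 2 w Ω) :
    ∫ x in Ω, ψ x * Laplacian.laplacian w x =
      - ∫ x in Ω, inner ℝ (gradient ψ x) (gradient w x) := by
  have key := fun i : Fin n => integral_mul_fderiv_eq_neg_of_hasCompactSupport hΩ hψ hc hs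
    (contDiffOn_fderiv_apply hΩ hw (EuclideanSpace.basisFun (Fin n) ℝ i))
    (EuclideanSpace.basisFun (Fin n) ℝ i)
  have h1 : ∫ x in Ω, ψ x * Laplacian.laplacian w x = ∫ x in Ω, ∑ i, ψ x * fderiv ℝ
      (fun y => fderiv ℝ w y (EuclideanSpace.basisFun (Fin n) ℝ i)) x
        (EuclideanSpace.basisFun (Fin n) ℝ i) := by
    refine setIntegral_congr_fun hΩ.measurableSet fun x hx => ?_
    simp only [laplacian_eq_sum_fderiv hΩ hw hx, Finset.mul_sum]
  have h2 : ∫ x in Ω, inner ℝ (gradient ψ x) (gradient w x) =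
      ∫ x in Ω, ∑ i, fderiv ℝ ψ x (EuclideanSpace.basisFun (Fin n) ℝ i) *
        fderiv ℝ w x (EuclideanSpace.basisFun (Fin n) ℝ i) := by
    refine integral_congr_ae (ae_of_all _ fun x => ?_)
    simp only
    rw [← (EuclideanSpace.basisFun (Fin n) ℝ).sum_inner_mul_inner]
    simp only [inner_gradient_left, inner_gradient_right, conj_trivial]
  rw [h1, h2, integral_finsetSum _ fun i _ => (key i).1.integrableOn,
    integral_finsetSum _ fun i _ => (key i).2.1.integrableOn, ← Finset.sum_neg_distrib]
  exact Finset.sum_congr rfl fun i _ => (key i).2.2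

/-! ### The positive part in `H¹₀` and its energy. -/

/-- Dominated convergence to zero in `L²`. -/
theorem tendsto_eLpNorm_two_of_dominated {α E : Type*} [MeasurableSpace α] {μ : Measure α}
    [NormedAddCommGroup E] {F : ℕ → α → E} {b : α → ℝ}
    (hF : ∀ k, AEStronglyMeasurable (F k) μ) (hb : MemLp b 2 μ)
    (hFb : ∀ k, ∀ᵐ x ∂μ, ‖F k x‖ ≤ ‖b x‖)
    (hlim : ∀ᵐ x ∂μ, Tendsto (fun k => F k x) atTop (𝓝 0)) :
    Tendsto (fun k => eLpNorm (F k) 2 μ) atTop (𝓝 0) := by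
  have h : Tendsto (fun k => ∫⁻ x, ‖F k x‖ₑ ^ (2 : ℝ) ∂μ) atTop (𝓝 (∫⁻ _, 0 ∂μ)) := by
    refine tendsto_lintegral_of_dominated_convergence' (fun x => ‖b x‖ₑ ^ (2 : ℝ))
      (fun k => (hF k).enorm.pow_const _) (fun k => ?_) ?_ ?_
    · filter_upwards [hFb k] with x hx
      exact ENNReal.rpow_le_rpow (enorm_le_iff_norm_le.2 hx) zero_le_two
    · simpa using (lintegral_rpow_enorm_lt_top_of_eLpNorm_lt_top two_ne_zero ENNReal.ofNat_ne_top
        hb.2).ne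
    · filter_upwards [hlim] with x hx
      have := ((ENNReal.continuous_rpow_const (y := 2)).tendsto _).comp hx.enorm
      simpa [Function.comp_def] using this
  have h2 := ((ENNReal.continuous_rpow_const (y := 1 / 2)).tendsto _).comp h
  simp only [lintegral_zero] at h2
  rw [ENNReal.zero_rpow_of_pos (by norm_num)] at h2
  refine h2.congr fun k => ?_
  rw [eLpNorm_eq_lintegral_rpow_enorm_toReal two_ne_zero ENNReal.ofNat_ne_top]
  simp

/-- Truncations of a function vanishing on the boundary are compactly supported. -/
theorem trunc_comp_properties {n : ℕ} {Ω : Set (EuclideanSpace ℝ (Fin n))} (hΩ : IsOpen Ω)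
    (hb : Bornology.IsBounded Ω) {w : EuclideanSpace ℝ (Fin n) → ℝ} (hw : ContDiffOn ℝ 1 w Ω)
    (hwc : ContinuousOn w (closure Ω)) (hw0 : ∀ x ∈ frontier Ω, w x = 0) {ε : ℝ} (hε : 0 < ε) :
    ContDiff ℝ 1 (Ω.indicator fun x => trunc ε (w x)) ∧
    HasCompactSupport (Ω.indicator fun x => trunc ε (w x)) ∧
    tsupport (Ω.indicator fun x => trunc ε (w x)) ⊆ Ω ∧
    ∀ x ∈ Ω, gradient (Ω.indicator fun x => trunc ε (w x)) x =
      truncSlope ε (w x) • gradient w x := by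
  set ψ := Ω.indicator fun x => trunc ε (w x) with hψ
  have hev : ∀ x ∈ Ω, ψ =ᶠ[𝓝 x] fun x => trunc ε (w x) := fun x hx => by
    filter_upwards [hΩ.mem_nhds hx] with y hy
    exact indicator_of_mem hy _
  -- The truncation is supported in this compact set, which misses the frontier because `w = 0 < ε`
  -- there.
  have hK : IsCompact (closure Ω ∩ w ⁻¹' Ici ε) :=
    (hb.isCompact_closure).of_isClosed_subset
      (hwc.preimage_isClosed_of_isClosed isClosed_closure isClosed_Ici) inter_subset_left
  have hts : tsupport ψ ⊆ closure Ω ∩ w ⁻¹' Ici ε := by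
    refine closure_minimal (fun x hx => ?_) hK.isClosed
    have hxΩ : x ∈ Ω := mem_of_indicator_ne_zero hx
    refine ⟨subset_closure hxΩ, ?_⟩
    by_contra h
    rw [mem_preimage, mem_Ici, not_le] at h
    refine hx ?_
    rw [hψ, indicator_of_mem hxΩ, trunc_eq_zero hε h.le]
  have htΩ : tsupport ψ ⊆ Ω := fun x hx => by
    by_contra h
    have : x ∈ frontier Ω := ⟨(hts hx).1, fun hi => h (interior_subset hi)⟩
    have h2 : ε ≤ w x := (hts hx).2
    rw [hw0 x this] at h2
    linarith
  refine ⟨contDiff_iff_contDiffAt.2 fun x => ?_, hK.of_isClosed_subset (isClosed_tsupport _) hts,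
    htΩ, fun x hx => ?_⟩
  · by_cases hx : x ∈ Ω
    · exact ((contDiff_trunc ε).contDiffAt.comp x
        (hw.contDiffAt (hΩ.mem_nhds hx))).congr_of_eventuallyEq (hev x hx)
    · exact (contDiffAt_const (c := (0 : ℝ))).congr_of_eventuallyEq
        (notMem_tsupport_iff_eventuallyEq.1 fun h => hx (htΩ h))
  · have hd := (hw.contDiffAt (hΩ.mem_nhds hx)).differentiableAt one_ne_zero
    have hf : fderiv ℝ (fun x => trunc ε (w x)) x = truncSlope ε (w x) • fderiv ℝ w x :=
      ((hasDerivAt_trunc ε (w x)).comp_hasFDerivAt x hd.hasFDerivAt).fderiv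
    rw [(hev x hx).gradient_eq, gradient, gradient, hf]
    simp

/-- Weak gradients pass to dominated pointwise limits of compactly supported `C¹` functions. -/
theorem hasWeakGradient_of_tendsto {n : ℕ} {Ω : Set (EuclideanSpace ℝ (Fin n))} (hΩ : IsOpen Ω)
    (hb : Bornology.IsBounded Ω)
    {φ : EuclideanSpace ℝ (Fin n) → ℝ} {g : EuclideanSpace ℝ (Fin n) → EuclideanSpace ℝ (Fin n)}
    (hφ : MemLp φ 2 (volume.restrict Ω)) (hg : MemLp g 2 (volume.restrict Ω))
    {ψ : ℕ → EuclideanSpace ℝ (Fin n) → ℝ} (hψ : ∀ k, ContDiff ℝ 1 (ψ k))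
    (hc : ∀ k, HasCompactSupport (ψ k)) (hs : ∀ k, tsupport (ψ k) ⊆ Ω)
    (hφb : ∀ k, ∀ x ∈ Ω, ‖ψ k x‖ ≤ ‖φ x‖) (hgb : ∀ k, ∀ x ∈ Ω, ‖gradient (ψ k) x‖ ≤ ‖g x‖)
    (hφl : ∀ x ∈ Ω, Tendsto (fun k => ψ k x) atTop (𝓝 (φ x)))
    (hgl : ∀ x ∈ Ω, Tendsto (fun k => gradient (ψ k) x) atTop (𝓝 (g x))) :
    HasWeakGradient Ω φ g := by
  have hfin : IsFiniteMeasure (volume.restrict Ω) :=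
    ⟨by simpa using hb.measure_lt_top⟩
  have hφi : IntegrableOn φ Ω := hφ.integrable one_le_two
  have hgi : IntegrableOn g Ω := hg.integrable one_le_two
  refine ⟨hφi.locallyIntegrableOn, hgi.locallyIntegrableOn, fun η hη e => ?_⟩
  have hη1 : ContDiff ℝ 1 η := hη.1.of_le (by norm_cast)
  have hdη : Continuous fun x => fderiv ℝ η x e :=
    (hη1.continuous_fderiv one_ne_zero).clm_apply continuous_const
  have hηL : MemLp η 2 (volume.restrict Ω) :=
    (hη1.continuous.memLp_of_hasCompactSupport hη.2.1).restrict _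
  have hdηL : MemLp (fun x => fderiv ℝ η x e) 2 (volume.restrict Ω) :=
    (hdη.memLp_of_hasCompactSupport (hη.2.1.fderiv_apply ℝ e)).restrict _
  have hgc : ∀ k, Continuous (gradient (ψ k)) := fun k =>
    (InnerProductSpace.toDual ℝ _).symm.continuous.comp ((hψ k).continuous_fderiv one_ne_zero)
  have l1 : Tendsto (fun k => ∫ x in Ω, ψ k x * fderiv ℝ η x e) atTop
      (𝓝 (∫ x in Ω, φ x * fderiv ℝ η x e)) := by
    refine tendsto_integral_of_dominated_convergence (fun x => ‖φ x‖ * ‖fderiv ℝ η x e‖)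
      (fun k => ((hψ k).continuous.mul hdη).aestronglyMeasurable)
      (hφ.norm.integrable_mul hdηL.norm) (fun k => ?_) ?_
    · filter_upwards [ae_restrict_mem hΩ.measurableSet] with x hx
      rw [norm_mul]
      exact mul_le_mul_of_nonneg_right (hφb k x hx) (norm_nonneg _)
    · filter_upwards [ae_restrict_mem hΩ.measurableSet] with x hx
      exact (hφl x hx).mul_const _
  have l2 : Tendsto (fun k => ∫ x in Ω, inner ℝ (gradient (ψ k) x) e * η x) atTop
      (𝓝 (∫ x in Ω, inner ℝ (g x) e * η x)) := by
    refine tendsto_integral_of_dominated_convergence (fun x => ‖e‖ * (‖g x‖ * ‖η x‖))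
      (fun k => (((hgc k).inner continuous_const).mul hη1.continuous).aestronglyMeasurable)
      ((hg.norm.integrable_mul hηL.norm).const_mul _) (fun k => ?_) ?_
    · filter_upwards [ae_restrict_mem hΩ.measurableSet] with x hx
      rw [norm_mul, ← mul_assoc, mul_comm ‖e‖]
      refine mul_le_mul_of_nonneg_right ((norm_inner_le_norm _ _).trans ?_) (norm_nonneg _)
      exact mul_le_mul_of_nonneg_right (hgb k x hx) (norm_nonneg _)
    · filter_upwards [ae_restrict_mem hΩ.measurableSet] with x hx
      exact ((hgl x hx).inner tendsto_const_nhds).mul_const _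
  -- For each `k` the identity is integration by parts against `ψ k`, with `η` as the other factor;
  -- both sides converge.
  refine tendsto_nhds_unique l1 (l2.neg.congr fun k => ?_)
  rw [(integral_mul_fderiv_eq_neg_of_hasCompactSupport hΩ (hψ k) (hc k) (hs k)
    hη1.contDiffOn e).2.2]
  simp only [inner_gradient_left]

/-- The positive part of a `C²` function vanishing on the boundary, with bounded Laplacian, lies in
`H¹₀` and satisfies the energy inequality. -/
theorem memH10_posPart {n : ℕ} {Ω : Set (EuclideanSpace ℝ (Fin n))} (hΩ : IsOpen Ω)
    (hb : Bornology.IsBounded Ω) {w : EuclideanSpace ℝ (Fin n) → ℝ} (hw : ContDiffOn ℝ 2 w Ω)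
    (hwc : ContinuousOn w (closure Ω)) (hw0 : ∀ x ∈ frontier Ω, w x = 0)
    {C : ℝ} (hC : ∀ x ∈ Ω, |Laplacian.laplacian w x| ≤ C) :
    MemH10 Ω (fun x => max (w x) 0) ((Ω ∩ w ⁻¹' Ioi 0).indicator (gradient w)) ∧
    ∫ x in Ω, ‖(Ω ∩ w ⁻¹' Ioi 0).indicator (gradient w) x‖ ^ 2 ≤
      ∫ x in Ω, -Laplacian.laplacian w x * max (w x) 0 := by
  have hfin : IsFiniteMeasure (volume.restrict Ω) :=
    ⟨by simpa using hb.measure_lt_top⟩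
  set φ : EuclideanSpace ℝ (Fin n) → ℝ := fun x => max (w x) 0
  set g := (Ω ∩ w ⁻¹' Ioi 0).indicator (gradient w) with hgdef
  have hw1 : ContDiffOn ℝ 1 w Ω := hw.of_le one_le_two
  have hwΩ : ContinuousOn w Ω := hw.continuousOn
  have hgradc : ContinuousOn (gradient w) Ω :=
    (InnerProductSpace.toDual ℝ _).symm.continuous.comp_continuousOn
      (hw1.continuousOn_fderiv_of_isOpen hΩ le_rfl)
  have hφc : ContinuousOn φ Ω := hwΩ.sup continuousOn_const
  have hφm : AEStronglyMeasurable φ (volume.restrict Ω) :=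
    hφc.aestronglyMeasurable hΩ.measurableSet
  have hopen : IsOpen (Ω ∩ w ⁻¹' Ioi 0) := hwΩ.isOpen_inter_preimage hΩ isOpen_Ioi
  have hgm : AEStronglyMeasurable g (volume.restrict Ω) :=
    (hgradc.aestronglyMeasurable hΩ.measurableSet).indicator hopen.measurableSet
  obtain ⟨B, hB⟩ := hb.isCompact_closure.exists_bound_of_continuousOn hwc
  have hφB : ∀ x ∈ Ω, ‖φ x‖ ≤ B := fun x hx => by
    have h1 := hB x (subset_closure hx)
    rw [Real.norm_eq_abs] at h1
    rw [Real.norm_of_nonneg (le_max_right _ _)]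
    exact max_le ((le_abs_self _).trans h1) ((abs_nonneg _).trans h1)
  have hφL : MemLp φ 2 (volume.restrict Ω) :=
    MemLp.of_bound hφm B ((ae_restrict_mem hΩ.measurableSet).mono hφB)
  let ε : ℕ → ℝ := fun k => 1 / ((k : ℝ) + 1)
  have hε : ∀ k, 0 < ε k := fun k => Nat.one_div_pos_of_nat
  have hε0 : Tendsto ε atTop (𝓝 0) := tendsto_one_div_add_atTop_nhds_zero_nat
  let ψ : ℕ → EuclideanSpace ℝ (Fin n) → ℝ := fun k => Ω.indicator fun x => trunc (ε k) (w x)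
  have hψ : ∀ k, ContDiff ℝ 1 (ψ k) := fun k =>
    (trunc_comp_properties hΩ hb hw1 hwc hw0 (hε k)).1
  have hc : ∀ k, HasCompactSupport (ψ k) := fun k =>
    (trunc_comp_properties hΩ hb hw1 hwc hw0 (hε k)).2.1
  have hs : ∀ k, tsupport (ψ k) ⊆ Ω := fun k =>
    (trunc_comp_properties hΩ hb hw1 hwc hw0 (hε k)).2.2.1
  have hgrad : ∀ k, ∀ x ∈ Ω, gradient (ψ k) x = truncSlope (ε k) (w x) • gradient w x := fun k =>
    (trunc_comp_properties hΩ hb hw1 hwc hw0 (hε k)).2.2.2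
  have hψx : ∀ k, ∀ x ∈ Ω, ψ k x = trunc (ε k) (w x) := fun k x hx => indicator_of_mem hx _
  have hψb : ∀ k, ∀ x ∈ Ω, ‖ψ k x‖ ≤ ‖φ x‖ := fun k x hx => by
    rw [hψx k x hx, Real.norm_of_nonneg (trunc_nonneg (hε k) _),
      Real.norm_of_nonneg (le_max_right _ _)]
    exact trunc_le (hε k) _
  have hψl : ∀ x ∈ Ω, Tendsto (fun k => ψ k x) atTop (𝓝 (φ x)) := fun x hx =>
    (tendsto_trunc hε hε0 (w x)).congr fun k => (hψx k x hx).symm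
  -- `g` may replace `gradient w` because the slope vanishes wherever `w ≤ 0`.
  have hgx : ∀ k, ∀ x ∈ Ω, gradient (ψ k) x = truncSlope (ε k) (w x) • g x := fun k x hx => by
    rw [hgrad k x hx]
    by_cases h : 0 < w x
    · rw [hgdef, indicator_of_mem (show x ∈ Ω ∩ w ⁻¹' Ioi 0 from ⟨hx, h⟩)]
    · rw [truncSlope_eq_zero (hε k) ((not_lt.1 h).trans (hε k).le), zero_smul, zero_smul]
  have hgb : ∀ k, ∀ x ∈ Ω, ‖gradient (ψ k) x‖ ≤ ‖g x‖ := fun k x hx => by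
    rw [hgx k x hx, norm_smul, Real.norm_of_nonneg (truncSlope_nonneg _ _)]
    exact mul_le_of_le_one_left (norm_nonneg _) (truncSlope_le_one _ _)
  have hslope : ∀ x ∈ Ω, Tendsto (fun k => truncSlope (ε k) (w x) • g x) atTop (𝓝 (g x)) :=
    fun x hx => by
    by_cases h : 0 < w x
    · simpa using (tendsto_truncSlope hε hε0 h).smul_const (g x)
    · have : g x = 0 := indicator_of_notMem (fun h' => h h'.2) _
      simp [this]
  have hgl : ∀ x ∈ Ω, Tendsto (fun k => gradient (ψ k) x) atTop (𝓝 (g x)) := fun x hx =>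
    (hslope x hx).congr fun k => (hgx k x hx).symm
  have hLc := continuousOn_laplacian hΩ hw
  let I := ∫ x in Ω, -Laplacian.laplacian w x * φ x
  let J : ℕ → ℝ := fun k => ∫ x in Ω, inner ℝ (gradient (ψ k) x) (gradient w x)
  -- Green's identity rewrites `J k` without gradients of `w`; then `|Δw| ≤ C` and `|ψ k| ≤ |φ| ≤ B`
  -- allow dominated convergence.
  have hJ : Tendsto J atTop (𝓝 I) := by
    have hgreen : ∀ k, ∫ x in Ω, -Laplacian.laplacian w x * ψ k x = J k := fun k => by
      have := integral_mul_laplacian hΩ (hψ k) (hc k) (hs k) hw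
      rw [← neg_eq_iff_eq_neg, ← integral_neg] at this
      refine Eq.trans ?_ this
      exact integral_congr_ae (ae_of_all _ fun x => by simp only; ring)
    refine Tendsto.congr hgreen ?_
    refine tendsto_integral_of_dominated_convergence (fun _ => C * B)
      (fun k => (hLc.aestronglyMeasurable hΩ.measurableSet).neg.mul
        (hψ k).continuous.aestronglyMeasurable) (integrable_const _) (fun k => ?_) ?_
    · filter_upwards [ae_restrict_mem hΩ.measurableSet] with x hx
      rw [norm_mul, norm_neg]
      exact mul_le_mul (hC x hx) ((hψb k x hx).trans (hφB x hx)) (norm_nonneg _)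
        ((abs_nonneg _).trans (hC x hx))
    · filter_upwards [ae_restrict_mem hΩ.measurableSet] with x hx
      exact (hψl x hx).const_mul _
  have hJx : ∀ k, ∀ x ∈ Ω, inner ℝ (gradient (ψ k) x) (gradient w x) =
      truncSlope (ε k) (w x) * ‖g x‖ ^ 2 := fun k x hx => by
    rw [hgx k x hx, real_inner_smul_left]
    by_cases h : 0 < w x
    · have : g x = gradient w x := indicator_of_mem (show x ∈ Ω ∩ w ⁻¹' Ioi 0 from ⟨hx, h⟩) _
      rw [this, real_inner_self_eq_norm_sq]
    · have : g x = 0 := indicator_of_notMem (fun h' => h h'.2) _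
      simp [this]
  have hJint : ∀ k, IntegrableOn (fun x => inner ℝ (gradient (ψ k) x) (gradient w x)) Ω :=
    fun k => by
    refine (integrable_of_continuousOn_compact (hc k).isCompact
      (ContinuousOn.inner (𝕜 := ℝ) ?_ (hgradc.mono (hs k))) fun x hx => ?_).integrableOn
    · exact ((InnerProductSpace.toDual ℝ _).symm.continuous.comp
        ((hψ k).continuous_fderiv one_ne_zero)).continuousOn
    · rw [inner_gradient_left, fderiv_eq_zero_of_notMem_tsupport hx]; rfl
  have hJnn : ∀ k, 0 ≤ᵐ[volume.restrict Ω]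
      fun x => inner ℝ (gradient (ψ k) x) (gradient w x) := fun k => by
    filter_upwards [ae_restrict_mem hΩ.measurableSet] with x hx
    rw [hJx k x hx]
    exact mul_nonneg (truncSlope_nonneg _ _) (sq_nonneg _)
  have hInn : 0 ≤ I := ge_of_tendsto' hJ fun k => integral_nonneg_of_ae (hJnn k)
  -- Integrability of `‖g‖²` is not yet known, so the limit is taken in `ENNReal`; the finite bound
  -- `I` then gives it.
  have hfatou : ∫⁻ x in Ω, ENNReal.ofReal (‖g x‖ ^ 2) ≤ ENNReal.ofReal I := by
    have hlim : ∀ x ∈ Ω, Tendsto (fun k => ENNReal.ofReal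
        (inner ℝ (gradient (ψ k) x) (gradient w x))) atTop (𝓝 (ENNReal.ofReal (‖g x‖ ^ 2))) :=
      fun x hx => by
      refine ENNReal.tendsto_ofReal ?_
      have := (hgl x hx).inner (𝕜 := ℝ) (tendsto_const_nhds (x := g x))
      rw [real_inner_self_eq_norm_sq] at this
      refine this.congr fun k => ?_
      rw [hJx k x hx, hgx k x hx, real_inner_smul_left, real_inner_self_eq_norm_sq]
    calc ∫⁻ x in Ω, ENNReal.ofReal (‖g x‖ ^ 2)
        = ∫⁻ x in Ω, liminf (fun k => ENNReal.ofReal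
            (inner ℝ (gradient (ψ k) x) (gradient w x))) atTop := by
          refine lintegral_congr_ae ?_
          filter_upwards [ae_restrict_mem hΩ.measurableSet] with x hx
          exact (hlim x hx).liminf_eq.symm
      _ ≤ liminf (fun k => ∫⁻ x in Ω, ENNReal.ofReal
            (inner ℝ (gradient (ψ k) x) (gradient w x))) atTop :=
          lintegral_liminf_le' fun k => (hJint k).aemeasurable.ennreal_ofReal
      _ = liminf (fun k => ENNReal.ofReal (J k)) atTop := by
          congr 1
          ext k
          exact (ofReal_integral_eq_lintegral_ofReal (hJint k) (hJnn k)).symm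
      _ = ENNReal.ofReal I := (ENNReal.tendsto_ofReal hJ).liminf_eq
  have hgint : IntegrableOn (fun x => ‖g x‖ ^ 2) Ω := by
    refine ⟨hgm.norm.pow 2, ?_⟩
    rw [hasFiniteIntegral_iff_ofReal (ae_of_all _ fun x => sq_nonneg _)]
    exact hfatou.trans_lt ENNReal.ofReal_lt_top
  have hgL : MemLp g 2 (volume.restrict Ω) :=
    (memLp_two_iff_integrable_sq_norm hgm).2 hgint
  have hgrc : ∀ k, Continuous (gradient (ψ k)) := fun k =>
    (InnerProductSpace.toDual ℝ _).symm.continuous.comp ((hψ k).continuous_fderiv one_ne_zero)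
  refine ⟨⟨⟨hφL, hgL, hasWeakGradient_of_tendsto hΩ hb hφL hgL hψ hc hs hψb hgb hψl hgl⟩,
    exists_testFunction_tendsto hΩ hb hφm hgm hψ hc hs ?_ ?_⟩, ?_⟩
  · refine tendsto_eLpNorm_two_of_dominated
      (fun k => (hψ k).continuous.aestronglyMeasurable.sub hφm) (hφL.norm.const_mul 2)
      (fun k => ?_) ?_
    · filter_upwards [ae_restrict_mem hΩ.measurableSet] with x hx
      rw [norm_mul, norm_norm, Real.norm_of_nonneg zero_le_two]
      linarith [norm_sub_le (ψ k x) (φ x), hψb k x hx]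
    · filter_upwards [ae_restrict_mem hΩ.measurableSet] with x hx
      simpa using (hψl x hx).sub_const (φ x)
  · refine tendsto_eLpNorm_two_of_dominated
      (fun k => (hgrc k).aestronglyMeasurable.sub hgm) (hgL.norm.const_mul 2)
      (fun k => ?_) ?_
    · filter_upwards [ae_restrict_mem hΩ.measurableSet] with x hx
      rw [norm_mul, norm_norm, Real.norm_of_nonneg zero_le_two]
      linarith [norm_sub_le (gradient (ψ k) x) (g x), hgb k x hx]
    · filter_upwards [ae_restrict_mem hΩ.measurableSet] with x hx
      simpa using (hgl x hx).sub_const (g x)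
  · rw [integral_eq_lintegral_of_nonneg_ae (ae_of_all _ fun x => sq_nonneg _) (hgm.norm.pow 2)]
    exact ENNReal.toReal_le_of_le_ofReal hInn hfatou

/-! ### Convexity and the comparison of solutions. -/

/-- A convex differentiable function lies above its tangents. -/
theorem sub_le_deriv_mul_sub {F : ℝ → ℝ} (hF : ConvexOn ℝ univ F) {a : ℝ}
    (hd : DifferentiableAt ℝ F a) (b : ℝ) : F a - F b ≤ deriv F a * (a - b) := by
  rcases lt_trichotomy a b with h | h | h
  · have := hF.le_slope_of_hasDerivAt (mem_univ a) (mem_univ b) h hd.hasDerivAt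
    rw [slope_def_field, le_div_iff₀ (by linarith)] at this
    linarith
  · simp [h]
  · have := hF.slope_le_of_hasDerivAt (mem_univ b) (mem_univ a) h hd.hasDerivAt
    rw [slope_def_field, div_le_iff₀ (by linarith)] at this
    linarith

/-- A stable solution lies below any other solution. -/
theorem le_of_isStable {n : ℕ} {Ω : Set (EuclideanSpace ℝ (Fin n))}
    (hΩ : IsOpen Ω) (hb : Bornology.IsBounded Ω) {f : EuclideanSpace ℝ (Fin n) → ℝ → ℝ}
    (hf : ContDiffOn ℝ 1 (fun p : EuclideanSpace ℝ (Fin n) × ℝ => f p.1 p.2) (Ω ×ˢ univ))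
    (hfb : ∀ M : ℝ, ∃ C : ℝ, ∀ x ∈ Ω, ∀ s ∈ Icc (-M) M, |deriv (f x) s| ≤ C)
    (hconv : ∀ x ∈ Ω, ConvexOn ℝ univ (f x)) {u v : EuclideanSpace ℝ (Fin n) → ℝ}
    (hu : IsSolution Ω f u) (hus : IsStable Ω f u) (hv : IsSolution Ω f v) :
    ∀ x ∈ Ω, u x ≤ v x := by
  have hfin : IsFiniteMeasure (volume.restrict Ω) :=
    ⟨by simpa using hb.measure_lt_top⟩
  obtain ⟨Bu, hBu⟩ := hb.isCompact_closure.exists_bound_of_continuousOn hu.continuousOn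
  obtain ⟨Bv, hBv⟩ := hb.isCompact_closure.exists_bound_of_continuousOn hv.continuousOn
  let M := max Bu Bv
  have huM : ∀ x ∈ Ω, u x ∈ Icc (-M) M := fun x hx =>
    abs_le.1 ((hBu x (subset_closure hx)).trans (le_max_left _ _))
  have hvM : ∀ x ∈ Ω, v x ∈ Icc (-M) M := fun x hx =>
    abs_le.1 ((hBv x (subset_closure hx)).trans (le_max_right _ _))
  obtain ⟨C, hC⟩ := hfb M
  have hopen : IsOpen (Ω ×ˢ (univ : Set ℝ)) := hΩ.prod isOpen_univ
  -- Writing `∂ₛf` as the total derivative applied to `(0, 1)` gives below the continuity of `x ↦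
  -- deriv (f x) (u x)`.
  have hfd : ∀ x ∈ Ω, ∀ s, HasDerivAt (f x)
      (fderiv ℝ (fun p : EuclideanSpace ℝ (Fin n) × ℝ => f p.1 p.2) (x, s) (0, 1)) s :=
    fun x hx s => by
    have h := ((hf.contDiffAt (hopen.mem_nhds (mk_mem_prod hx (mem_univ s)))).differentiableAt
      one_ne_zero).hasFDerivAt
    exact h.comp_hasDerivAt (f := fun t => (x, t)) s
      ((hasDerivAt_const s x).prodMk (hasDerivAt_id s))
  let w : EuclideanSpace ℝ (Fin n) → ℝ := u - v
  have hw : ContDiffOn ℝ 2 w Ω := hu.contDiffOn.sub hv.contDiffOn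
  have hLap : ∀ x ∈ Ω, -Laplacian.laplacian w x = f x (u x) - f x (v x) := fun x hx => by
    have h : Laplacian.laplacian w x = _ :=
      (hu.contDiffOn.contDiffAt (hΩ.mem_nhds hx)).laplacian_sub
        (hv.contDiffOn.contDiffAt (hΩ.mem_nhds hx))
    rw [h, ← hu.eq_interior x hx, ← hv.eq_interior x hx]
    ring
  -- Mean value inequality: `C` bounds `∂ₛf` on `[-M, M]`, where both values lie, and `|u - v| ≤ M +
  -- M`.
  have hLb : ∀ x ∈ Ω, |Laplacian.laplacian w x| ≤ C * (M + M) := fun x hx => by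
    have h := (convex_Icc (-M) M).norm_image_sub_le_of_norm_deriv_le
      (fun s _ => (hfd x hx s).differentiableAt) (hC x hx) (hvM x hx) (huM x hx)
    have hC0 : 0 ≤ C := (abs_nonneg _).trans (hC x hx _ (huM x hx))
    rw [← abs_neg, hLap x hx]
    refine h.trans (mul_le_mul_of_nonneg_left ?_ hC0)
    rw [Real.norm_eq_abs, abs_le]
    constructor <;> linarith [(huM x hx).1, (huM x hx).2, (hvM x hx).1, (hvM x hx).2]
  obtain ⟨hmem, henergy⟩ := memH10_posPart hΩ hb hw (hu.continuousOn.sub hv.continuousOn)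
    (fun x hx => by simp [w, hu.eq_boundary x hx, hv.eq_boundary x hx]) hLb
  have hwΩ : ContinuousOn w Ω := hw.continuousOn
  have hφc : ContinuousOn (fun x => max (w x) 0) Ω := hwΩ.sup continuousOn_const
  have hφi : IntegrableOn (fun x => max (w x) 0) Ω := hmem.1.1.integrable one_le_two
  have hφ2 : IntegrableOn (fun x => max (w x) 0 ^ 2) Ω := hmem.1.1.integrable_sq
  have hdc : ContinuousOn (fun x => deriv (f x) (u x)) Ω := by
    have h := (hf.continuousOn_fderiv_of_isOpen hopen le_rfl).comp
      (f := fun x => (x, u x)) (s := Ω) (continuousOn_id.prodMk hu.contDiffOn.continuousOn)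
      fun x hx => ⟨hx, mem_univ _⟩
    exact (h.clm_apply (continuousOn_const (c := (0, 1)))).congr
      fun x hx => (hfd x hx (u x)).deriv
  have hi1 : IntegrableOn (fun x => -Laplacian.laplacian w x * max (w x) 0) Ω := by
    refine hφi.bdd_mul (c := C * (M + M))
      ((continuousOn_laplacian hΩ hw).aestronglyMeasurable hΩ.measurableSet).neg ?_
    filter_upwards [ae_restrict_mem hΩ.measurableSet] with x hx
    rw [norm_neg]
    exact hLb x hx
  have hi2 : IntegrableOn (fun x => deriv (f x) (u x) * max (w x) 0 ^ 2) Ω := by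
    refine hφ2.bdd_mul (c := C) (hdc.aestronglyMeasurable hΩ.measurableSet) ?_
    filter_upwards [ae_restrict_mem hΩ.measurableSet] with x hx
    exact hC x hx _ (huM x hx)
  have hle : ∫ x in Ω, -Laplacian.laplacian w x * max (w x) 0 ≤
      ∫ x in Ω, deriv (f x) (u x) * max (w x) 0 ^ 2 := by
    refine setIntegral_mono_on hi1 hi2 hΩ.measurableSet fun x hx => ?_
    rw [hLap x hx]
    -- Where `w ≤ 0` both sides vanish; elsewhere the tangent inequality at `u x` is multiplied by
    -- `w x ≥ 0`.
    rcases le_total (w x) 0 with h | h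
    · simp [max_eq_right h]
    · rw [max_eq_left h, sq, ← mul_assoc]
      exact mul_le_mul_of_nonneg_right
        (sub_le_deriv_mul_sub (hconv x hx) (hfd x hx _).differentiableAt _) h
  -- Otherwise stability of `u` would make strictly positive a difference that `henergy` and `hle`
  -- show to be at most zero.
  have hzero : (fun x => max (w x) 0) =ᵐ[volume.restrict Ω] 0 := by
    by_contra h
    linarith [hus _ _ hmem h]
  have heq : EqOn (fun x => max (w x) 0) 0 Ω :=
    Measure.eqOn_open_of_ae_eq hzero hΩ hφc continuousOn_const
  intro x hx
  have h : max (w x) 0 = 0 := heq hx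
  exact sub_nonpos.1 (max_eq_right_iff.1 h)

end StableElliptic

theorem lemma3p1 {n : ℕ} (Ω : Set (EuclideanSpace ℝ (Fin n)))
    (hΩ_open : IsOpen Ω) (hΩ_bdd : Bornology.IsBounded Ω)
    (f : EuclideanSpace ℝ (Fin n) → ℝ → ℝ)
    (hf_smooth : ContDiffOn ℝ 1 (fun p : EuclideanSpace ℝ (Fin n) × ℝ => f p.1 p.2)
      (Ω ×ˢ Set.univ))
    (hf_bdd : ∀ M : ℝ, ∃ C : ℝ, ∀ x ∈ Ω, ∀ s ∈ Set.Icc (-M) M, |deriv (f x) s| ≤ C)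
    (hf_convex : ∀ x ∈ Ω, ConvexOn ℝ Set.univ (f x))
    (u v : EuclideanSpace ℝ (Fin n) → ℝ)
    (hu : StableElliptic.IsPositiveStableSolution Ω f u)
    (hv : StableElliptic.IsPositiveStableSolution Ω f v) :
    Set.EqOn u v (closure Ω) := by
  have huv := StableElliptic.le_of_isStable hΩ_open hΩ_bdd hf_smooth hf_bdd hf_convex
    hu.isSolution hu.isStable hv.isSolution
  have hvu := StableElliptic.le_of_isStable hΩ_open hΩ_bdd hf_smooth hf_bdd hf_convex
    hv.isSolution hv.isStable hu.isSolution
  intro x hx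
  by_cases h : x ∈ Ω
  · exact le_antisymm (huv x h) (hvu x h)
  · have hfr : x ∈ frontier Ω := ⟨hx, fun hi => h (interior_subset hi)⟩
    rw [hu.isSolution.eq_boundary x hfr, hv.isSolution.eq_boundary x hfr]
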